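/- Let $n\ge 1$, $q\in\mathbb C$ with $0<|q|<1$, and let $\tau=(\tau_1,\dots,\tau_n)\in\mathbb C^n$ satisfy $0<|\tau_1|<|\tau_2|<\cdots<|\tau_n|<1$. For $\alpha\in\mathbb Z^n$ put $|\alpha|:=|\alpha_1|+\cdots+|\alpha_n|$. The degree of a Laurent polynomial $f=\sum_\alpha c_\alpha x^\alpha\in\mathbb C[x_1^{\pm1},\dots,x_n^{\pm1}]$ is $\deg f:=\max\{|\alpha| : c_\alpha\neq 0\}$, with $\deg 0:=-\infty$. For $J\subseteq\{1,\dots,n\}$ put $x_J:=\prod_{j\in J}x_j$, and put $\operatorname{sgn}(a):=1$ if $a\ge 0$, $\operatorname{sgn}(a):=-1$ if $a<0$. For $\alpha\in\mathbb Z^n$ let $\pi_\alpha\in S_n$ be the unique permutation such that, for all $i<j$, $$\pi_\alpha^{-1}(i)<\pi_\alpha^{-1}(j)\iff |\alpha_i|>|\alpha_j|\ \text{ or }\ 0\le\alpha_i=\pm\alpha_j,$$ and define the interpolation point $\overline\alpha\in(\mathbb C\setminus\{0\})^n$ by $$\overline\alpha_i:=q^{\alpha_i}\bigl(\tau_{\pi_\alpha^{-1}(i)}\bigr)^{\operatorname{sgn}(\alpha_i)}\qquad(1\le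 i\le n).$$ For $d\in\mathbb Z_{\ge0}$ and $I\subseteq\{1,\dots,n\}$ with complement $I^{\mathsf c}$ put $$\Lambda_{n,d}:=\{\alpha\in\mathbb Z^n : |\alpha|\le d\},$$ $$R(n,d,I):=\{\alpha\in\Lambda_{n,d} : \alpha_j\ne0 \text{ for all } j,\ \text{and } \alpha_i\neq-1 \text{ for } i\in I^{\mathsf c}\},$$ $$T(n,d,I):=\{\alpha\in\Lambda_{n,d} : \alpha_i\neq0 \text{ for } i\in I^{\mathsf c}\}.$$ Then, for every $d\in\mathbb Z_{\ge 0}$: (a) For every $I\subseteq\{1,\dots,n\}$ and every map $\overline f\colon R(n,d,I)\to\mathbb C$ there is a Laurent polynomial $f$ with $f(\overline\alpha)=\overline f(\alpha)$ for all $\alpha\in R(n,d,I)$ and $\deg(x_Jf)\le d-n+|I|$ for all $J\subseteq I$. (b) For every $I\subseteq\{1,\dots,n\}$ and every map $\overline f\colon T(n,d,I)\to\mathbb C$ there is a Laurent polynomial $f$ with $f(\overline\alpha)=\overline f(\alpha)$ for all $\alpha\in T(n,d,I)$ and $\deg(x_Jf)\le d$ for all $J\subseteq I^{\mathsf c}$.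 (c) For every map $\overline f\colon\Lambda_{n,d}\to\mathbb C$ there is a unique Laurent polynomial $f$ of degree $\le d$ such that $f(\overline\alpha)=\overline f(\alpha)$ for all $\alpha\in\Lambda_{n,d}$. (d) Consequently the nonsymmetric interpolation polynomials are well defined: for every $\alpha\in\mathbb Z^n$ there is a unique Laurent polynomial $G_\alpha$ of degree $\le|\alpha|$ with $G_\alpha(\overline\alpha)=1$ and $G_\alpha(\overline\beta)=0$ for all $\beta\in\mathbb Z^n$ with $|\beta|\le|\alpha|$, $\beta\ne\alpha$. -/

import Mathlib

namespace LaurentInterp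

/-- The `ℂ`-algebra `ℂ[x₁^{±1}, …, xₙ^{±1}]` of Laurent polynomials in `n` variables. -/
abbrev LaurentPoly (n : ℕ) : Type := AddMonoidAlgebra ℂ (Fin n → ℤ)

/-- The weight `|α| = |α₁| + ⋯ + |αₙ|`. -/
def weight {n : ℕ} (α : Fin n → ℤ) : ℤ := ∑ i, |α i|

/-- The degree of a Laurent polynomial: the largest weight of an exponent that occurs in it,
and `⊥` (that is, `-∞`) for the zero polynomial. -/
def degree {n : ℕ} (f : LaurentPoly n) : WithBot ℤ :=
  f.coeff.support.sup fun α => (weight α : WithBot ℤ)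

/-- The value of a Laurent polynomial at a point `x`, of interest when all `x i ≠ 0`. -/
noncomputable def eval {n : ℕ} (x : Fin n → ℂ) (f : LaurentPoly n) : ℂ :=
  f.coeff.sum fun α c => c * ∏ i, x i ^ α i

/-- The monomial `x_J = ∏_{j ∈ J} x_j`. -/
noncomputable def xProd {n : ℕ} (J : Finset (Fin n)) : LaurentPoly n :=
  AddMonoidAlgebra.single (fun i => if i ∈ J then 1 else 0) 1

/-- The sign, with the convention that the sign of `0` is `1`. -/
def sgn (a : ℤ) : ℤ := if 0 ≤ a then 1 else -1

/-- Sorting key for the positions of `α`: larger `|α i|` first; among positions with the same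
`|α i|` first those with `α i ≥ 0` in increasing order, then those with `α i < 0` in decreasing
order. -/
def sortKey {n : ℕ} (α : Fin n → ℤ) (i : Fin n) : ℤ ×ₗ ℤ :=
  toLex (-|α i|, if 0 ≤ α i then (i : ℤ) else 2 * (n : ℤ) - (i : ℤ))

/-- The permutation `π_α`, which lists the positions of `α` in the order of `sortKey`. So
`(|α_{π(1)}|, …, |α_{π(n)}|)` is the partition `α⁺`, and within a block of equal absolute values
`a` the positions with `α = a ≥ 0` come first, increasingly, followed by those with
`α = -a < 0`, decreasingly. -/
def sortPerm {n : ℕ} (α : Fin n → ℤ) : Equiv.Perm (Fin n) := Tuple.sort (sortKey α)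

theorem sortKey_lt_iff {n : ℕ} (α : Fin n → ℤ) {i j : Fin n} (hij : i < j) :
    sortKey α i < sortKey α j ↔
      (|α j| < |α i| ∨ (0 ≤ α i ∧ (α i = α j ∨ α i = -α j))) := by
  have hi := i.2
  have hj := j.2
  have hij' : (i : ℕ) < (j : ℕ) := hij
  unfold sortKey
  rw [Prod.Lex.toLex_lt_toLex]
  dsimp only
  split_ifs <;> grind

theorem sortKey_injective {n : ℕ} (α : Fin n → ℤ) : Function.Injective (sortKey α) := by
  intro i j h
  have hi := i.2
  have hj := j.2
  unfold sortKey at h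
  rw [toLex_inj, Prod.mk.injEq] at h
  apply Fin.ext
  have h2 := h.2
  split_ifs at h2 <;> omega

theorem sortPerm_symm_lt_iff_sortKey {n : ℕ} (α : Fin n → ℤ) (i j : Fin n) :
    (sortPerm α).symm i < (sortPerm α).symm j ↔ sortKey α i < sortKey α j := by
  have hm : StrictMono (sortKey α ∘ sortPerm α) :=
    (Tuple.monotone_sort (sortKey α)).strictMono_of_injective
      ((sortKey_injective α).comp (sortPerm α).injective)
  have := hm.lt_iff_lt (a := (sortPerm α).symm i) (b := (sortPerm α).symm j)
  simpa using this.symm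

/-- `π_α` is the unique permutation such that, for `i < j`, one has `π_α⁻¹(i) < π_α⁻¹(j)` if and
only if `|α i| > |α j|` or `0 ≤ α i = ± α j`. -/
theorem eq_sortPerm_iff {n : ℕ} (α : Fin n → ℤ) (π : Equiv.Perm (Fin n)) :
    π = sortPerm α ↔
      ∀ i j : Fin n, i < j → (π.symm i < π.symm j ↔
        (|α j| < |α i| ∨ (0 ≤ α i ∧ (α i = α j ∨ α i = -α j)))) := by
  constructor
  · rintro rfl i j hij
    rw [sortPerm_symm_lt_iff_sortKey, sortKey_lt_iff α hij]
  · intro h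
    have key : ∀ i j : Fin n, π.symm i < π.symm j ↔ sortKey α i < sortKey α j := by
      intro i j
      rcases lt_trichotomy i j with hij | rfl | hij
      · rw [h i j hij, sortKey_lt_iff α hij]
      · simp
      · have h1 := h j i hij
        rw [← sortKey_lt_iff α hij] at h1
        have hne : π.symm i ≠ π.symm j := fun e => hij.ne' (π.symm.injective e)
        have hne' : sortKey α i ≠ sortKey α j := fun e => hij.ne' (sortKey_injective α e)
        constructor
        · intro hl
          exact lt_of_le_of_ne (not_lt.1 fun c => lt_asymm hl (h1.2 c)) hne'
        · intro hl
          exact lt_of_le_of_ne (not_lt.1 fun c => lt_asymm hl (h1.1 c)) hne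
    have hm : Monotone (sortKey α ∘ π) := by
      apply StrictMono.monotone
      intro a b hab
      have := key (π a) (π b)
      simp only [Equiv.symm_apply_apply] at this
      exact this.1 hab
    have := Tuple.unique_monotone hm (Tuple.monotone_sort (sortKey α))
    ext a
    exact congrArg _ (sortKey_injective α (congrFun this a))

/-- The parameters `τ` with `0 < |τ₁| < |τ₂| < ⋯ < |τₙ| < 1`. -/
def paramSet (n : ℕ) : Set (Fin n → ℂ) :=
  {τ | (∀ i, 0 < ‖τ i‖) ∧ (∀ i j, i < j → ‖τ i‖ < ‖τ j‖) ∧ ∀ i, ‖τ i‖ < 1}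

/-- The interpolation point `ᾱ(q, τ)`, with
`ᾱ i = q ^ (α i) * (τ (π_α⁻¹ i)) ^ sgn (α i)`. -/
noncomputable def point {n : ℕ} (q : ℂ) (τ : Fin n → ℂ) (α : Fin n → ℤ) : Fin n → ℂ :=
  fun i => q ^ α i * τ ((sortPerm α).symm i) ^ sgn (α i)

/-- `Λ_{n,d}`: the `α ∈ ℤⁿ` of weight at most `d`. -/
def indexSet (n d : ℕ) : Set (Fin n → ℤ) := {α | weight α ≤ d}

/-- `R(n,d,I)`: the `α ∈ Λ_{n,d}` with `α j ≠ 0` for all `j`, and `α i ≠ -1` for `i ∉ I`. -/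
def indexSetR (n d : ℕ) (I : Finset (Fin n)) : Set (Fin n → ℤ) :=
  {α | α ∈ indexSet n d ∧ (∀ j, α j ≠ 0) ∧ ∀ i, i ∉ I → α i ≠ -1}

/-- `T(n,d,I)`: the `α ∈ Λ_{n,d}` with `α i ≠ 0` for `i ∉ I`. -/
def indexSetT (n d : ℕ) (I : Finset (Fin n)) : Set (Fin n → ℤ) :=
  {α | α ∈ indexSet n d ∧ ∀ i, i ∉ I → α i ≠ 0}

/-- `f` is a nonsymmetric interpolation Laurent polynomial `G_α( · ; q, τ)`: it has degree at
most `|α|`, takes the value `1` at `ᾱ`, and vanishes at `β̄` for every `β ≠ α` with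
`|β| ≤ |α|`. -/
def IsNonsymmetricInterp {n : ℕ} (q : ℂ) (τ : Fin n → ℂ) (α : Fin n → ℤ)
    (f : LaurentPoly n) : Prop :=
  degree f ≤ (weight α : WithBot ℤ) ∧ eval (point q τ α) f = 1 ∧
    ∀ β : Fin n → ℤ, weight β ≤ weight α → β ≠ α → eval (point q τ β) f = 0

end LaurentInterp

/-!
If `k` is the largest index at which `α` may vanish, then `α k = 0` puts `k` last in the order
defining `π_α`, and the `k`-th coordinate of the interpolation point is `τ_n`; no other value of
`α k` produces this coordinate. Likewise, if `α` has no zeros and `k` is the smallest index at which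
`-1` is allowed, then `α k = -1` if and only if that coordinate is `(q τ_n)⁻¹`. So one step of
Newton interpolation with the factor `x_k - τ_n` (resp. `x_k⁻¹ - q τ_n`) forbids the value `0`
(resp. `-1`) at `k`, at the price of a problem in `n - 1` variables with `τ_n` omitted. Once `0` and
`-1` are forbidden at every index, moving each coordinate of `α` by one towards `0` and replacing
`τ` by `q τ` leaves the points unchanged and lowers the weight by `n`. Uniqueness is a dimension
count: there are as many exponents of weight at most `d` as interpolation points.
-/

namespace LaurentInterp

open AddMonoidAlgebra (single supported coeffLinearEquiv mem_supported)

variable {m n d : ℕ} {ι κ : Type*}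

/-- Evaluation of Laurent polynomials at `x` as a linear map. It is defined on all of `ℂⁿ`, but it
is multiplicative only at points without zero coordinates, because `0 ^ (-1) = 0`. -/
noncomputable def evalLinearMap (x : Fin n → ℂ) : LaurentPoly n →ₗ[ℂ] ℂ :=
  Finsupp.linearCombination ℂ (fun α : Fin n → ℤ => ∏ i, x i ^ α i) ∘ₗ
    (coeffLinearEquiv ℂ).toLinearMap

theorem evalLinearMap_apply (x : Fin n → ℂ) (f : LaurentPoly n) :
    evalLinearMap x f = eval x f := by
  simp [evalLinearMap, eval, Finsupp.linearCombination_apply]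

theorem eval_zero (x : Fin n → ℂ) : eval x 0 = 0 := by
  simp [eval]

theorem eval_add (x : Fin n → ℂ) (f g : LaurentPoly n) :
    eval x (f + g) = eval x f + eval x g := by
  simp only [← evalLinearMap_apply, map_add]

theorem eval_sub (x : Fin n → ℂ) (f g : LaurentPoly n) :
    eval x (f - g) = eval x f - eval x g := by
  simp only [← evalLinearMap_apply, map_sub]

theorem eval_single (x : Fin n → ℂ) (α : Fin n → ℤ) (c : ℂ) :
    eval x (single α c) = c * ∏ i, x i ^ α i := by
  simp [eval]

theorem eval_mul {x : Fin n → ℂ} (hx : ∀ i, x i ≠ 0) (f g : LaurentPoly n) :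
    eval x (f * g) = eval x f * eval x g := by
  induction f using AddMonoidAlgebra.induction_linear with
  | zero => simp only [zero_mul, eval_zero]
  | add f₁ f₂ h₁ h₂ => rw [add_mul, eval_add, eval_add, h₁, h₂, add_mul]
  | single α a =>
    induction g using AddMonoidAlgebra.induction_linear with
    | zero => simp only [mul_zero, eval_zero]
    | add g₁ g₂ h₁ h₂ => rw [mul_add, eval_add, eval_add, h₁, h₂, mul_add]
    | single β b =>
      simp only [AddMonoidAlgebra.single_mul_single, eval_single, Pi.add_apply,
        fun i => zpow_add₀ (hx i), Finset.prod_mul_distrib]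
      ring

theorem single_mem_supported {S : Set (Fin n → ℤ)} {α : Fin n → ℤ} (hα : α ∈ S) (c : ℂ) :
    single α c ∈ supported ℂ ℂ S := by
  rw [mem_supported, AddMonoidAlgebra.coeff_single]
  exact Finsupp.single_mem_supported ℂ c hα

theorem single_mul_mem_supported {S T : Set (Fin n → ℤ)} {α : Fin n → ℤ}
    (h : ∀ β ∈ S, α + β ∈ T) (c : ℂ) {f : LaurentPoly n} (hf : f ∈ supported ℂ ℂ S) :
    single α c * f ∈ supported ℂ ℂ T := by
  classical
  intro γ hγ
  obtain ⟨β, hβ, rfl⟩ := Finset.mem_image.1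
    (AddMonoidAlgebra.support_coeff_single_mul_subset f c α hγ)
  exact h β (hf hβ)

theorem degree_le_iff {D : ℤ} {f : LaurentPoly n} :
    degree f ≤ (D : WithBot ℤ) ↔ f ∈ supported ℂ ℂ {α : Fin n → ℤ | weight α ≤ D} := by
  simp [degree, mem_supported, Set.subset_def]

/-- The inclusion of the Laurent polynomials in the variables other than `x_k`. -/
noncomputable def includeVars (k : Fin (n + 1)) (f : LaurentPoly n) : LaurentPoly (n + 1) :=
  AddMonoidAlgebra.mapDomain (fun β => (k.insertNth 0 β : Fin (n + 1) → ℤ)) f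

theorem eval_includeVars (k : Fin (n + 1)) (x : Fin (n + 1) → ℂ) (f : LaurentPoly n) :
    eval x (includeVars k f) = eval (x ∘ k.succAbove) f := by
  rw [eval, includeVars, AddMonoidAlgebra.coeff_mapDomain, Finsupp.sum_mapDomain_index]
  · simp [eval, Fin.prod_univ_succAbove _ k]
  · simp
  · simp [add_mul]

theorem includeVars_mem_supported (k : Fin (n + 1)) {S : Set (Fin n → ℤ)}
    {T : Set (Fin (n + 1) → ℤ)} (h : ∀ β ∈ S, (k.insertNth 0 β : Fin (n + 1) → ℤ) ∈ T)
    {f : LaurentPoly n} (hf : f ∈ supported ℂ ℂ S) : includeVars k f ∈ supported ℂ ℂ T := by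
  classical
  intro γ hγ
  obtain ⟨β, hβ, rfl⟩ := Finset.mem_image.1 (Finsupp.mapDomain_support hγ)
  exact h β (hf hβ)

/-- Arbitrary values at the points `x α`, `α ∈ S`, are interpolated by a Laurent polynomial with
exponents in `E`. The values are given on all of `ι`, so that restricting `S` needs no coercions. -/
def Interpolates (x : ι → Fin n → ℂ) (S : Set ι) (E : Set (Fin n → ℤ)) : Prop :=
  ∀ v : ι → ℂ, ∃ f ∈ supported ℂ ℂ E, ∀ α ∈ S, eval (x α) f = v α

namespace Interpolates

variable {x : ι → Fin n → ℂ} {S S' : Set ι} {E E' : Set (Fin n → ℤ)}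

theorem mono (h : Interpolates x S E) (hS : S' ⊆ S) (hE : E ⊆ E') : Interpolates x S' E' :=
  fun v =>
    let ⟨f, hf, hv⟩ := h v
    ⟨f, AddMonoidAlgebra.supported_mono hE hf, fun α hα => hv α (hS hα)⟩

theorem empty : Interpolates x ∅ E :=
  fun _ => ⟨0, Submodule.zero_mem _, fun _ hα => hα.elim⟩

theorem of_subsingleton (hS : S.Subsingleton) (hE : 0 ∈ E) : Interpolates x S E := by
  rcases hS.eq_empty_or_singleton with rfl | ⟨α, rfl⟩
  · exact empty
  · refine fun v => ⟨single 0 (v α), single_mem_supported hE _, ?_⟩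
    rintro _ rfl
    simp [eval_single]

theorem exists_eval_eq (h : Interpolates x S E) (v : S → ℂ) :
    ∃ f ∈ supported ℂ ℂ E, ∀ α : S, eval (x α) f = v α := by
  obtain ⟨f, hf, hv⟩ := h (Function.extend Subtype.val v 0)
  exact ⟨f, hf, fun α => (hv α α.2).trans (Subtype.val_injective.extend_apply v 0 α)⟩

theorem of_injOn {y : κ → Fin n → ℂ} {T : Set κ} {r : ι → κ} (h : Interpolates y T E)
    (hr : Set.MapsTo r S T) (hinj : Set.InjOn r S) (hy : ∀ α ∈ S, y (r α) = x α) :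
    Interpolates x S E := by
  intro v
  obtain ⟨f, hf, hv⟩ := h (Function.extend (S.domRestrict r) (S.domRestrict v) 0)
  refine ⟨f, hf, fun α hα => ?_⟩
  rw [← hy α hα, hv (r α) (hr hα)]
  exact hinj.injective.extend_apply (S.domRestrict v) 0 ⟨α, hα⟩

theorem of_succAbove {x : ι → Fin (n + 1) → ℂ} {E' : Set (Fin (n + 1) → ℤ)} {k : Fin (n + 1)}
    (h : Interpolates (fun α => x α ∘ k.succAbove) S E)
    (hE : ∀ β ∈ E, (k.insertNth 0 β : Fin (n + 1) → ℤ) ∈ E') : Interpolates x S E' := by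
  intro v
  obtain ⟨f, hf, hv⟩ := h v
  exact ⟨includeVars k f, includeVars_mem_supported k hE hf, fun α hα =>
    (eval_includeVars k (x α) f).trans (hv α hα)⟩

-- Newton interpolation: correct an interpolant for the zeros of `g` by a multiple of `g`.
theorem of_mul {g : LaurentPoly n} (hx : ∀ α ∈ S, ∀ i, x α i ≠ 0)
    (hg : ∀ f ∈ supported ℂ ℂ E, g * f ∈ supported ℂ ℂ E')
    (h_zero : Interpolates x {α ∈ S | eval (x α) g = 0} E')
    (h_ne : Interpolates x {α ∈ S | eval (x α) g ≠ 0} E) : Interpolates x S E' := by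
  intro v
  obtain ⟨f₀, hf₀, hv₀⟩ := h_zero v
  obtain ⟨f₁, hf₁, hv₁⟩ := h_ne fun α => (v α - eval (x α) f₀) / eval (x α) g
  refine ⟨f₀ + g * f₁, Submodule.add_mem _ hf₀ (hg f₁ hf₁), fun α hα => ?_⟩
  rw [eval_add, eval_mul (hx α hα)]
  by_cases hgα : eval (x α) g = 0
  · rw [hgα, zero_mul, add_zero, hv₀ α ⟨hα, hgα⟩]
  · rw [hv₁ α ⟨hα, hgα⟩, mul_div_cancel₀ _ hgα, add_sub_cancel]

theorem of_coordinate {k : Fin n} {s : ℤ} {c : ℂ} (hx : ∀ α ∈ S, ∀ i, x α i ≠ 0)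
    (hE : ∀ β ∈ E, β ∈ E' ∧ Pi.single k s + β ∈ E')
    (h_eq : Interpolates x {α ∈ S | x α k ^ s = c} E')
    (h_ne : Interpolates x {α ∈ S | x α k ^ s ≠ c} E) : Interpolates x S E' := by
  have eval_binomial (α : ι) :
      eval (x α) (single (Pi.single k s) 1 - single 0 c) = x α k ^ s - c := by
    simp [eval_sub, eval_single, Pi.single_apply]
  refine of_mul (E := E) (g := single (Pi.single k s) 1 - single 0 c) hx (fun f hf => ?_) ?_ ?_
  · rw [sub_mul]
    exact Submodule.sub_mem _ (single_mul_mem_supported (fun β hβ => (hE β hβ).2) 1 hf)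
      (single_mul_mem_supported (fun β hβ => (zero_add β).symm ▸ (hE β hβ).1) c hf)
  · simpa only [eval_binomial, sub_eq_zero] using h_eq
  · simpa only [eval_binomial, sub_ne_zero] using h_ne

-- Evaluation on `S` maps a space of dimension `|E|` onto one of dimension `|S|`.
theorem eq_of_eval_eq (h : Interpolates x S E) (hS : S.Finite) (hE : E.Finite)
    (hcard : E.ncard = S.ncard) {f g : LaurentPoly n} (hf : f ∈ supported ℂ ℂ E)
    (hg : g ∈ supported ℂ ℂ E) (hfg : ∀ α ∈ S, eval (x α) f = eval (x α) g) : f = g := by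
  have : Fintype S := hS.fintype
  have : Fintype E := hE.fintype
  let e : supported ℂ ℂ E ≃ₗ[ℂ] (E → ℂ) :=
    AddMonoidAlgebra.supportedEquivFinsupp E ≪≫ₗ Finsupp.linearEquivFunOnFinite ℂ ℂ E
  let φ : supported ℂ ℂ E →ₗ[ℂ] (S → ℂ) :=
    LinearMap.pi fun α => evalLinearMap (x α) ∘ₗ (supported ℂ ℂ E).subtype
  have φ_apply (p : supported ℂ ℂ E) (α : S) : φ p α = eval (x α) p := evalLinearMap_apply _ _
  have : FiniteDimensional ℂ (supported ℂ ℂ E) := e.symm.finiteDimensional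
  have finrank_eq : Module.finrank ℂ (supported ℂ ℂ E) = Module.finrank ℂ (S → ℂ) := by
    rw [e.finrank_eq, Module.finrank_fintype_fun_eq_card, Module.finrank_fintype_fun_eq_card,
      ← Nat.card_eq_fintype_card, ← Nat.card_eq_fintype_card]
    exact hcard
  have surjective : Function.Surjective φ := fun v =>
    let ⟨p, hp, hv⟩ := h.exists_eval_eq v
    ⟨⟨p, hp⟩, funext fun α => (φ_apply _ α).trans (hv α)⟩
  have injective : Function.Injective φ :=
    (LinearMap.injective_iff_surjective_of_finrank_eq_finrank finrank_eq).2 surjective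
  have : (⟨f, hf⟩ : supported ℂ ℂ E) = ⟨g, hg⟩ := injective <| funext fun α => by
    rw [φ_apply, φ_apply, hfg α α.2]
  exact congrArg Subtype.val this

end Interpolates

theorem weight_nonneg (α : Fin n → ℤ) : 0 ≤ weight α :=
  Finset.sum_nonneg fun _ _ => abs_nonneg _

theorem abs_le_weight (α : Fin n → ℤ) (i : Fin n) : |α i| ≤ weight α :=
  Finset.single_le_sum (f := fun i => |α i|) (fun _ _ => abs_nonneg _) (Finset.mem_univ i)

theorem natCast_le_weight {α : Fin n → ℤ} (hα : ∀ i, α i ≠ 0) : (n : ℤ) ≤ weight α := by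
  have : ∑ _i : Fin n, (1 : ℤ) ≤ weight α := Finset.sum_le_sum fun i _ => Int.one_le_abs (hα i)
  simpa using this

theorem weight_succAbove (k : Fin (n + 1)) (α : Fin (n + 1) → ℤ) :
    weight α = |α k| + weight (α ∘ k.succAbove) := by
  simp [weight, Fin.sum_univ_succAbove _ k]

theorem finite_setOf_weight_le (D : ℤ) : {α : Fin n → ℤ | weight α ≤ D}.Finite :=
  (Set.Finite.pi' fun _ : Fin n => Set.finite_Icc (-D) D).subset fun α hα i =>
    abs_le.1 ((abs_le_weight α i).trans hα)

/-- The indices `i` of the variables other than `x_k` whose position `k.succAbove i` among all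
variables lies in `I`. -/
noncomputable def restrict (k : Fin (n + 1)) (I : Finset (Fin (n + 1))) : Finset (Fin n) :=
  I.preimage k.succAbove k.succAbove_right_injective.injOn

theorem mem_restrict {k : Fin (n + 1)} {I : Finset (Fin (n + 1))} {i : Fin n} :
    i ∈ restrict k I ↔ k.succAbove i ∈ I :=
  Finset.mem_preimage

theorem card_restrict {k : Fin (n + 1)} {I : Finset (Fin (n + 1))} (hk : k ∉ I) :
    (restrict k I).card = I.card := by
  classical
  rw [restrict, Finset.card_preimage, Finset.filter_true_of_mem]
  intro i hi
  rw [Fin.range_succAbove]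
  exact fun hik => hk (hik ▸ hi)

/-- The largest degree of `x_J x^β` for `J ⊆ I`; it is attained at `J = {i ∈ I | 0 ≤ β i}`. -/
def shiftedWeight (I : Finset (Fin n)) (β : Fin n → ℤ) : ℤ :=
  ∑ i, (|β i| + if i ∈ I ∧ 0 ≤ β i then 1 else 0)

theorem shiftedWeight_empty (β : Fin n → ℤ) : shiftedWeight ∅ β = weight β := by
  simp [shiftedWeight, weight]

theorem shiftedWeight_succAbove (k : Fin (n + 1)) (I : Finset (Fin (n + 1)))
    (β : Fin (n + 1) → ℤ) :
    shiftedWeight I β = (|β k| + if k ∈ I ∧ 0 ≤ β k then 1 else 0) +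
      shiftedWeight (restrict k I) (β ∘ k.succAbove) := by
  simp [shiftedWeight, Fin.sum_univ_succAbove _ k, mem_restrict]

theorem weight_add_le_shiftedWeight {I J : Finset (Fin n)} (hJ : J ⊆ I) (β : Fin n → ℤ) :
    weight ((fun i => if i ∈ J then 1 else 0) + β) ≤ shiftedWeight I β := by
  refine Finset.sum_le_sum fun i _ => ?_
  have := @hJ i
  simp only [Pi.add_apply]
  grind

/-- The exponents `β` such that `x_J x^β` has degree at most `D` for all `J ⊆ I`. -/
def exponentSet (I : Finset (Fin n)) (D : ℤ) : Set (Fin n → ℤ) :=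
  {β | shiftedWeight I β ≤ D}

theorem exponentSet_empty (D : ℤ) :
    exponentSet (∅ : Finset (Fin n)) D = {β | weight β ≤ D} := by
  simp only [exponentSet, shiftedWeight_empty]

theorem degree_xProd_mul_le {I J : Finset (Fin n)} (hJ : J ⊆ I) {D : ℤ} {f : LaurentPoly n}
    (hf : f ∈ supported ℂ ℂ (exponentSet I D)) : degree (xProd J * f) ≤ (D : WithBot ℤ) :=
  degree_le_iff.2 <| single_mul_mem_supported
    (fun β hβ => (weight_add_le_shiftedWeight hJ β).trans hβ) 1 hf

theorem sortKey_comp_lt_iff {σ : Fin m → Fin n} (hσ : StrictMono σ) (α : Fin n → ℤ) (i j : Fin m) :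
    sortKey (α ∘ σ) i < sortKey (α ∘ σ) j ↔ sortKey α (σ i) < sortKey α (σ j) := by
  have hij : (σ i : ℕ) < σ j ↔ (i : ℕ) < j := hσ.lt_iff_lt
  have hji : (σ j : ℕ) < σ i ↔ (j : ℕ) < i := hσ.lt_iff_lt
  unfold sortKey
  simp only [Prod.Lex.toLex_lt_toLex, Function.comp_apply]
  split_ifs <;> omega

theorem sortPerm_symm_val (α : Fin n → ℤ) (i : Fin n) :
    ((sortPerm α).symm i : ℕ) = Finset.card {j | sortKey α j < sortKey α i} := by
  calc ((sortPerm α).symm i : ℕ) = (Finset.Iio ((sortPerm α).symm i)).card := (Fin.card_Iio _).symm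
    _ = _ := Finset.card_equiv (sortPerm α) fun j => by
      rw [Finset.mem_Iio, Finset.mem_filter_univ, ← sortPerm_symm_lt_iff_sortKey,
        Equiv.symm_apply_apply]

section LastPosition

variable {α : Fin (n + 1) → ℤ} {k : Fin (n + 1)}

theorem sortPerm_symm_eq_last (hk : ∀ j ≠ k, sortKey α j < sortKey α k) :
    (sortPerm α).symm k = Fin.last n := by
  have : ({j | sortKey α j < sortKey α k} : Finset (Fin (n + 1))) = {k}ᶜ := by
    ext j
    simp only [Finset.mem_filter_univ, Finset.mem_compl, Finset.mem_singleton]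
    exact ⟨fun h hj => h.ne (hj ▸ rfl), hk j⟩
  apply Fin.ext
  rw [sortPerm_symm_val, this, Finset.card_compl, Finset.card_singleton, Fintype.card_fin,
    Fin.val_last, Nat.add_sub_cancel]

theorem sortPerm_symm_succAbove (hk : ∀ j ≠ k, sortKey α j < sortKey α k) (i : Fin n) :
    (sortPerm α).symm (k.succAbove i) = ((sortPerm (α ∘ k.succAbove)).symm i).castSucc := by
  have hki : ¬ sortKey α k < sortKey α (k.succAbove i) := (hk _ (Fin.succAbove_ne k i)).not_gt
  apply Fin.ext
  simp only [Fin.val_castSucc, sortPerm_symm_val, Finset.card_filter,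
    Fin.sum_univ_succAbove _ k, if_neg hki, zero_add,
    sortKey_comp_lt_iff (Fin.strictMono_succAbove k)]

theorem point_apply_last (hk : ∀ j ≠ k, sortKey α j < sortKey α k) (q : ℂ)
    (τ : Fin (n + 1) → ℂ) : point q τ α k = q ^ α k * τ (Fin.last n) ^ sgn (α k) := by
  rw [point, sortPerm_symm_eq_last hk]

theorem point_comp_succAbove (hk : ∀ j ≠ k, sortKey α j < sortKey α k) (q : ℂ)
    (τ : Fin (n + 1) → ℂ) :
    point q τ α ∘ k.succAbove = point q (τ ∘ Fin.castSucc) (α ∘ k.succAbove) := by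
  ext i
  simp only [point, Function.comp_apply, sortPerm_symm_succAbove hk]

end LastPosition

/-- The translation of `α` by one towards the origin in every coordinate, for `α` without
coordinates `0` and `-1`: these are the coordinates at which `α i - sgn (α i)` changes sign. -/
def shrink (α : Fin n → ℤ) : Fin n → ℤ := fun i => α i - sgn (α i)

section Shrink

variable {α : Fin n → ℤ}

theorem sgn_shrink (h0 : ∀ i, α i ≠ 0) (h1 : ∀ i, α i ≠ -1) (i : Fin n) :
    sgn (shrink α i) = sgn (α i) := by
  have := h0 i
  have := h1 i
  grind [shrink, sgn]

theorem abs_shrink (h0 : ∀ i, α i ≠ 0) (i : Fin n) : |shrink α i| = |α i| - 1 := by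
  have := h0 i
  grind [shrink, sgn]

theorem weight_shrink (h0 : ∀ i, α i ≠ 0) : weight (shrink α) = weight α - n := by
  simp [weight, abs_shrink h0]

theorem sortPerm_shrink (h0 : ∀ i, α i ≠ 0) (h1 : ∀ i, α i ≠ -1) :
    sortPerm (shrink α) = sortPerm α := by
  have hkey (i j : Fin n) :
      sortKey (shrink α) i < sortKey (shrink α) j ↔ sortKey α i < sortKey α j := by
    have nonneg_iff (i : Fin n) : 0 ≤ shrink α i ↔ 0 ≤ α i := by
      have := sgn_shrink h0 h1 i
      grind [sgn]
    simp only [sortKey, Prod.Lex.toLex_lt_toLex, abs_shrink h0, nonneg_iff]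
    omega
  apply Equiv.symm_bijective.injective
  ext i
  simp only [sortPerm_symm_val, hkey]

theorem point_smul_shrink {q : ℂ} (hq : q ≠ 0) (τ : Fin n → ℂ) (h0 : ∀ i, α i ≠ 0)
    (h1 : ∀ i, α i ≠ -1) : point q (q • τ) (shrink α) = point q τ α := by
  ext i
  rw [point, point, sortPerm_shrink h0 h1, sgn_shrink h0 h1, Pi.smul_apply, smul_eq_mul, mul_zpow,
    ← mul_assoc, ← zpow_add₀ hq, shrink, sub_add_cancel]

theorem injOn_shrink :
    Set.InjOn shrink {α : Fin n → ℤ | (∀ i, α i ≠ 0) ∧ ∀ i, α i ≠ -1} := by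
  rintro α ⟨hα0, hα1⟩ β ⟨hβ0, hβ1⟩ h
  ext i
  have hsgn : sgn (α i) = sgn (β i) := by rw [← sgn_shrink hα0 hα1, h, sgn_shrink hβ0 hβ1]
  have := congrFun h i
  rwa [shrink, shrink, hsgn, sub_left_inj] at this

end Shrink

/-- The inequalities between `q` and `τ` under which the interpolation argument works: no positive
power of `q` is a quotient `τ j / τ i` with `i ≤ j` (in particular `q` is not a root of unity), or
an inverse product `(τ i * τ j)⁻¹`. -/
structure IsGeneric (q : ℂ) (τ : Fin n → ℂ) : Prop where
  q_ne_zero : q ≠ 0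
  ne_zero : ∀ i, τ i ≠ 0
  pow_mul_ne : ∀ {i j : Fin n}, i ≤ j → ∀ {e : ℕ}, e ≠ 0 → q ^ e * τ i ≠ τ j
  pow_mul_mul_ne_one : ∀ (i j : Fin n) {e : ℕ}, e ≠ 0 → q ^ e * τ i * τ j ≠ 1

theorem isGeneric_of_mem_paramSet {q : ℂ} (hq0 : 0 < ‖q‖) (hq1 : ‖q‖ < 1) {τ : Fin n → ℂ}
    (hτ : τ ∈ paramSet n) : IsGeneric q τ := by
  obtain ⟨hτ0, hτ_lt, hτ1⟩ := hτ
  have norm_lt (i : Fin n) {e : ℕ} (he : e ≠ 0) : ‖q ^ e * τ i‖ < ‖τ i‖ := by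
    rw [norm_mul, norm_pow]
    exact mul_lt_of_lt_one_left (hτ0 i) (pow_lt_one₀ hq0.le hq1 he)
  have norm_mono : Monotone fun i => ‖τ i‖ := StrictMono.monotone fun i j => hτ_lt i j
  refine ⟨norm_pos_iff.1 hq0, fun i => norm_pos_iff.1 (hτ0 i), fun {i j} hij e he h => ?_,
    fun i j e he h => ?_⟩
  · exact ((norm_lt i he).trans_le (norm_mono hij)).ne (congrArg norm h)
  · have : ‖q ^ e * τ i * τ j‖ < 1 := by
      rw [norm_mul]
      exact mul_lt_one_of_nonneg_of_lt_one_left (norm_nonneg _) ((norm_lt i he).trans (hτ1 i))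
        (hτ1 j).le
    exact this.ne (by rw [h, norm_one])

namespace IsGeneric

variable {q : ℂ}

theorem comp_castSucc {τ : Fin (n + 1) → ℂ} (h : IsGeneric q τ) :
    IsGeneric q (τ ∘ Fin.castSucc) where
  q_ne_zero := h.q_ne_zero
  ne_zero _ := h.ne_zero _
  pow_mul_ne hij _ he := h.pow_mul_ne (Fin.castSucc_le_castSucc_iff.2 hij) he
  pow_mul_mul_ne_one _ _ _ he := h.pow_mul_mul_ne_one _ _ he

theorem smul {τ : Fin n → ℂ} (h : IsGeneric q τ) : IsGeneric q (q • τ) where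
  q_ne_zero := h.q_ne_zero
  ne_zero i := mul_ne_zero h.q_ne_zero (h.ne_zero i)
  pow_mul_ne {i j} hij e he heq := h.pow_mul_ne hij he <| mul_left_cancel₀ h.q_ne_zero <| by
    rw [mul_left_comm]
    exact heq
  pow_mul_mul_ne_one i j e _ heq := h.pow_mul_mul_ne_one i j (e + 1).succ_ne_zero <| by
    rw [Nat.succ_eq_add_one, ← heq, Pi.smul_apply, Pi.smul_apply, smul_eq_mul, smul_eq_mul]
    ring

theorem point_ne_zero {τ : Fin n → ℂ} (h : IsGeneric q τ) (α : Fin n → ℤ) (i : Fin n) :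
    point q τ α i ≠ 0 :=
  mul_ne_zero (zpow_ne_zero _ h.q_ne_zero) (zpow_ne_zero _ (h.ne_zero _))

end IsGeneric

theorem point_of_pos (q : ℂ) (τ : Fin n → ℂ) {α : Fin n → ℤ} {i : Fin n} (h : 0 < α i) :
    point q τ α i = q ^ (α i).natAbs * τ ((sortPerm α).symm i) := by
  rw [point, sgn, if_pos h.le, zpow_one, ← zpow_natCast, Int.natAbs_of_nonneg h.le]

theorem point_of_neg (q : ℂ) (τ : Fin n → ℂ) {α : Fin n → ℤ} {i : Fin n} (h : α i < 0) :
    point q τ α i = (q ^ (α i).natAbs * τ ((sortPerm α).symm i))⁻¹ := by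
  rw [point, sgn, if_neg h.not_ge, zpow_neg_one, mul_inv, ← zpow_natCast, ← zpow_neg,
    Int.ofNat_natAbs_of_nonpos h.le, neg_neg]

section GenericLast

variable {q : ℂ} {τ : Fin (n + 1) → ℂ} {α : Fin (n + 1) → ℤ} {k : Fin (n + 1)}

theorem IsGeneric.point_ne_last (h : IsGeneric q τ) (hα : α k ≠ 0) :
    point q τ α k ≠ τ (Fin.last n) := by
  have he : (α k).natAbs ≠ 0 := Int.natAbs_ne_zero.2 hα
  rcases hα.lt_or_gt with hneg | hpos
  · rw [point_of_neg q τ hneg]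
    intro heq
    apply h.pow_mul_mul_ne_one ((sortPerm α).symm k) (Fin.last n) he
    rw [← heq, mul_inv_cancel₀ (mul_ne_zero (pow_ne_zero _ h.q_ne_zero) (h.ne_zero _))]
  · rw [point_of_pos q τ hpos]
    exact h.pow_mul_ne (Fin.le_last _) he

theorem IsGeneric.inv_point_ne_mul_last (h : IsGeneric q τ) (hα0 : α k ≠ 0) (hα1 : α k ≠ -1) :
    (point q τ α k)⁻¹ ≠ q * τ (Fin.last n) := by
  rcases hα0.lt_or_gt with hneg | hpos
  · obtain ⟨e, he⟩ : ∃ e, (α k).natAbs = e + 1 := ⟨(α k).natAbs - 1, by omega⟩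
    rw [point_of_neg q τ hneg, inv_inv, he, pow_succ', mul_assoc]
    exact fun heq => h.pow_mul_ne (Fin.le_last _) (by omega) (mul_left_cancel₀ h.q_ne_zero heq)
  · rw [point_of_pos q τ hpos]
    intro heq
    apply h.pow_mul_mul_ne_one ((sortPerm α).symm k) (Fin.last n) (α k).natAbs.succ_ne_zero
    calc q ^ ((α k).natAbs + 1) * τ ((sortPerm α).symm k) * τ (Fin.last n)
      _ = q ^ (α k).natAbs * τ ((sortPerm α).symm k) * (q * τ (Fin.last n)) := by ring
      _ = 1 := by
        rw [← heq, mul_inv_cancel₀ (mul_ne_zero (pow_ne_zero _ h.q_ne_zero) (h.ne_zero _))]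

end GenericLast

theorem indexSetT_univ : indexSetT n d Finset.univ = indexSet n d := by
  simp [indexSetT]

theorem indexSetR_univ : indexSetR n d Finset.univ = indexSetT n d ∅ := by
  simp [indexSetR, indexSetT]

theorem indexSetR_eq_empty (hd : d < n) (I : Finset (Fin n)) : indexSetR n d I = ∅ :=
  Set.eq_empty_of_forall_notMem fun α hα => by
    have : weight α ≤ d := hα.1
    have := natCast_le_weight hα.2.1
    omega

section InductionSteps

variable {q : ℂ}

theorem interpolates_indexSetR_empty {τ : Fin n → ℂ} (hq : q ≠ 0) {E : Set (Fin n → ℤ)}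
    (h : Interpolates (point q (q • τ)) (indexSet n d) E) :
    Interpolates (point q τ) (indexSetR n (d + n) ∅) E := by
  have ne_neg_one {α} (hα : α ∈ indexSetR n (d + n) ∅) (i : Fin n) : α i ≠ -1 :=
    hα.2.2 i (Finset.notMem_empty i)
  refine h.of_injOn (r := shrink) (fun α hα => ?_)
    (injOn_shrink.mono fun _ hα => .intro hα.2.1 (ne_neg_one hα))
    (fun α hα => point_smul_shrink hq τ hα.2.1 (ne_neg_one hα))
  have : weight α ≤ (d + n : ℕ) := hα.1
  rw [indexSet, Set.mem_ofPred_eq, weight_shrink hα.2.1]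
  omega

variable {τ : Fin (n + 1) → ℂ} {k : Fin (n + 1)}

theorem interpolates_of_forall_sortKey_lt {a : ℤ} {S : Set (Fin (n + 1) → ℤ)}
    {S₀ E₀ : Set (Fin n → ℤ)} {E : Set (Fin (n + 1) → ℤ)}
    (h : Interpolates (point q (τ ∘ Fin.castSucc)) S₀ E₀) (ha : ∀ α ∈ S, α k = a)
    (hk : ∀ α ∈ S, ∀ j ≠ k, sortKey α j < sortKey α k) (hS : ∀ α ∈ S, α ∘ k.succAbove ∈ S₀)
    (hE : ∀ β ∈ E₀, (k.insertNth 0 β : Fin (n + 1) → ℤ) ∈ E) : Interpolates (point q τ) S E := by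
  refine (h.of_injOn hS ?_ fun α hα => (point_comp_succAbove (hk α hα) q τ).symm).of_succAbove hE
  intro α hα β hβ hαβ
  ext i
  rcases Fin.eq_self_or_eq_succAbove k i with rfl | ⟨i, rfl⟩
  · rw [ha α hα, ha β hβ]
  · exact congrFun hαβ i

variable {I : Finset (Fin (n + 1))}

theorem restrict_insert_self : restrict k (insert k I) = restrict k I := by
  ext i
  simp [mem_restrict]

theorem restrict_compl : restrict k Iᶜ = (restrict k I)ᶜ := by
  ext i
  simp [mem_restrict]

theorem single_add_comp_succAbove (s : ℤ) (β : Fin (n + 1) → ℤ) :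
    (Pi.single k s + β) ∘ k.succAbove = β ∘ k.succAbove := by
  ext i
  simp

theorem insertNth_comp_succAbove (a : ℤ) (β : Fin n → ℤ) :
    (k.insertNth a β : Fin (n + 1) → ℤ) ∘ k.succAbove = β := by
  ext i
  simp

theorem sortKey_lt_of_mem_indexSetR_insert {α : Fin (n + 1) → ℤ} (hk : ∀ i ∈ I, k < i)
    (hα : α ∈ indexSetR (n + 1) d (insert k I)) (hαk : α k = -1) {j : Fin (n + 1)} (hj : j ≠ k) :
    sortKey α j < sortKey α k := by
  have := hα.2.1 j
  have := hα.2.2 j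
  have := hk j
  simp only [sortKey, Prod.Lex.toLex_lt_toLex]
  grind

theorem sortKey_lt_of_mem_indexSetT_insert {α : Fin (n + 1) → ℤ} (hk : ∀ i ∈ I, i < k)
    (hα : α ∈ indexSetT (n + 1) d (insert k I)) (hαk : α k = 0) {j : Fin (n + 1)} (hj : j ≠ k) :
    sortKey α j < sortKey α k := by
  have := hα.2 j
  have := hk j
  simp only [sortKey, Prod.Lex.toLex_lt_toLex]
  grind

theorem IsGeneric.inv_point_eq_mul_last_iff (hτ : IsGeneric q τ) {α : Fin (n + 1) → ℤ}
    (hk : ∀ i ∈ I, k < i) (hα : α ∈ indexSetR (n + 1) d (insert k I)) :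
    (point q τ α k)⁻¹ = q * τ (Fin.last n) ↔ α k = -1 := by
  refine ⟨not_imp_not.1 (hτ.inv_point_ne_mul_last (hα.2.1 k)), fun hαk => ?_⟩
  rw [point_apply_last (fun _ => sortKey_lt_of_mem_indexSetR_insert hk hα hαk), hαk]
  simp [sgn, mul_comm]

theorem IsGeneric.point_eq_last_iff (hτ : IsGeneric q τ) {α : Fin (n + 1) → ℤ}
    (hk : ∀ i ∈ I, i < k) (hα : α ∈ indexSetT (n + 1) d (insert k I)) :
    point q τ α k = τ (Fin.last n) ↔ α k = 0 := by
  refine ⟨not_imp_not.1 hτ.point_ne_last, fun hαk => ?_⟩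
  rw [point_apply_last (fun _ => sortKey_lt_of_mem_indexSetT_insert hk hα hαk), hαk]
  simp [sgn]

theorem IsGeneric.interpolates_indexSetR_insert (hτ : IsGeneric q τ) {D : ℤ} (hk : ∀ i ∈ I, k < i)
    (h₀ : Interpolates (point q (τ ∘ Fin.castSucc)) (indexSetR n d (restrict k I))
      (exponentSet (restrict k I) D))
    (h : Interpolates (point q τ) (indexSetR (n + 1) (d + 1) I) (exponentSet I D)) :
    Interpolates (point q τ) (indexSetR (n + 1) (d + 1) (insert k I))
      (exponentSet (insert k I) (D + 1)) := by
  have inv_eq_iff {α} (hα : α ∈ indexSetR (n + 1) (d + 1) (insert k I)) :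
      point q τ α k ^ (-1 : ℤ) = q * τ (Fin.last n) ↔ α k = -1 := by
    rw [zpow_neg_one, hτ.inv_point_eq_mul_last_iff hk hα]
  have mem_exponentSet {β} (hβ : β ∈ exponentSet I D) : β ∈ exponentSet (insert k I) (D + 1) ∧
      Pi.single k (-1) + β ∈ exponentSet (insert k I) (D + 1) := by
    simp only [exponentSet, Set.mem_ofPred_eq, shiftedWeight_succAbove k, restrict_insert_self,
      single_add_comp_succAbove, Pi.add_apply, Pi.single_eq_same] at hβ ⊢
    grind
  refine Interpolates.of_coordinate (k := k) (s := -1) (c := q * τ (Fin.last n))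
    (fun α _ => hτ.point_ne_zero α) (fun β => mem_exponentSet)
    (interpolates_of_forall_sortKey_lt h₀ (fun α hα => (inv_eq_iff hα.1).1 hα.2)
      (fun α hα _ => sortKey_lt_of_mem_indexSetR_insert hk hα.1 ((inv_eq_iff hα.1).1 hα.2))
      ?mem_indexSetR ?insertNth_mem)
    (h.mono ?subset_indexSetR subset_rfl)
  case mem_indexSetR =>
    rintro α ⟨hα, h_eq⟩
    have hαk := (inv_eq_iff hα).1 h_eq
    obtain ⟨hαd, hα0, hα1⟩ := hα
    refine ⟨?_, fun j => hα0 _, fun i hi => hα1 _ ?_⟩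
    · simp only [indexSet, Set.mem_ofPred_eq, weight_succAbove k, hαk] at hαd ⊢
      grind
    · simpa [mem_restrict] using hi
  case insertNth_mem =>
    intro β hβ
    simp only [exponentSet, Set.mem_ofPred_eq, shiftedWeight_succAbove k, restrict_insert_self,
      insertNth_comp_succAbove, Fin.insertNth_apply_same, abs_zero] at hβ ⊢
    split_ifs <;> omega
  case subset_indexSetR =>
    rintro α ⟨hα, h_ne⟩
    have hαk : α k ≠ -1 := h_ne ∘ (inv_eq_iff hα).2
    exact ⟨hα.1, hα.2.1, fun i hi => by grind [hα.2.2 i]⟩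

theorem IsGeneric.interpolates_indexSetT_insert (hτ : IsGeneric q τ) {D : ℤ} (hk : ∀ i ∈ I, i < k)
    (h₀ : Interpolates (point q (τ ∘ Fin.castSucc)) (indexSetT n d (restrict k I))
      (exponentSet (restrict k I)ᶜ D))
    (h : Interpolates (point q τ) (indexSetT (n + 1) d I) (exponentSet Iᶜ D)) :
    Interpolates (point q τ) (indexSetT (n + 1) d (insert k I))
      (exponentSet (insert k I)ᶜ D) := by
  have hkI : k ∉ I := fun hkI => (hk k hkI).false
  have point_eq_iff {α} (hα : α ∈ indexSetT (n + 1) d (insert k I)) :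
      point q τ α k ^ (1 : ℤ) = τ (Fin.last n) ↔ α k = 0 := by
    rw [zpow_one, hτ.point_eq_last_iff hk hα]
  have mem_exponentSet {β} (hβ : β ∈ exponentSet Iᶜ D) : β ∈ exponentSet (insert k I)ᶜ D ∧
      Pi.single k 1 + β ∈ exponentSet (insert k I)ᶜ D := by
    simp only [exponentSet, Set.mem_ofPred_eq, shiftedWeight_succAbove k, restrict_compl,
      restrict_insert_self, single_add_comp_succAbove, Pi.add_apply, Pi.single_eq_same,
      Finset.mem_compl, Finset.mem_insert_self] at hβ ⊢
    grind
  refine Interpolates.of_coordinate (k := k) (s := 1) (c := τ (Fin.last n))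
    (fun α _ => hτ.point_ne_zero α) (fun β => mem_exponentSet)
    (interpolates_of_forall_sortKey_lt h₀ (fun α hα => (point_eq_iff hα.1).1 hα.2)
      (fun α hα _ => sortKey_lt_of_mem_indexSetT_insert hk hα.1 ((point_eq_iff hα.1).1 hα.2))
      ?mem_indexSetT ?insertNth_mem)
    (h.mono ?subset_indexSetT subset_rfl)
  case mem_indexSetT =>
    rintro α ⟨hα, h_eq⟩
    have hαk := (point_eq_iff hα).1 h_eq
    obtain ⟨hαd, hα0⟩ := hα
    refine ⟨?_, fun i hi => hα0 _ ?_⟩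
    · simpa [indexSet, weight_succAbove k, hαk] using hαd
    · simpa [mem_restrict] using hi
  case insertNth_mem =>
    intro β hβ
    simpa [exponentSet, shiftedWeight_succAbove k, restrict_compl, restrict_insert_self,
      insertNth_comp_succAbove, -Finset.compl_insert] using hβ
  case subset_indexSetT =>
    rintro α ⟨hα, h_ne⟩
    have hαk : α k ≠ 0 := h_ne ∘ (point_eq_iff hα).2
    exact ⟨hα.1, fun i hi => by grind [hα.2 i]⟩

theorem IsGeneric.interpolates_indexSetR_succ (hτ : IsGeneric q τ) {D : ℤ}
    (h₀ : ∀ I, Interpolates (point q (τ ∘ Fin.castSucc)) (indexSetR n d I)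
      (exponentSet I (D + I.card)))
    (h : Interpolates (point q τ) (indexSetR (n + 1) (d + 1) ∅) (exponentSet ∅ D))
    (I : Finset (Fin (n + 1))) :
    Interpolates (point q τ) (indexSetR (n + 1) (d + 1) I) (exponentSet I (D + I.card)) := by
  induction I using Finset.induction_on_min with
  | empty => simpa using h
  | insert k I hk ih =>
    have hkI : k ∉ I := fun hkI => (hk k hkI).false
    rw [Finset.card_insert_of_notMem hkI, Nat.cast_add_one, ← add_assoc]
    exact hτ.interpolates_indexSetR_insert hk (card_restrict hkI ▸ h₀ (restrict k I)) ih

theorem IsGeneric.interpolates_indexSetT_succ (hτ : IsGeneric q τ) {D : ℤ}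
    (h₀ : ∀ I, Interpolates (point q (τ ∘ Fin.castSucc)) (indexSetT n d I) (exponentSet Iᶜ D))
    (h : Interpolates (point q τ) (indexSetT (n + 1) d ∅) (exponentSet Finset.univ D))
    (I : Finset (Fin (n + 1))) :
    Interpolates (point q τ) (indexSetT (n + 1) d I) (exponentSet Iᶜ D) := by
  induction I using Finset.induction_on_max with
  | empty => rwa [Finset.compl_empty]
  | insert k I hk ih => exact hτ.interpolates_indexSetT_insert hk (h₀ _) ih

end InductionSteps

theorem zero_mem_exponentSet {I : Finset (Fin n)} {D : ℤ} (hD : I.card ≤ D) :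
    0 ∈ exponentSet I D := by
  simpa [exponentSet, shiftedWeight] using hD

namespace IsGeneric

variable {q : ℂ} {τ : Fin n → ℂ}

theorem interpolates_indexSetR_and_indexSetT (hτ : IsGeneric q τ) (d : ℕ) :
    (∀ I, Interpolates (point q τ) (indexSetR n d I) (exponentSet I (d - n + I.card))) ∧
      ∀ I, Interpolates (point q τ) (indexSetT n d I) (exponentSet Iᶜ d) := by
  induction n generalizing d with
  | zero =>
    exact ⟨fun I => .of_subsingleton Set.subsingleton_of_subsingleton
        (zero_mem_exponentSet (by simp)),
      fun I => .of_subsingleton Set.subsingleton_of_subsingleton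
        (zero_mem_exponentSet (by simp [Finset.eq_empty_of_isEmpty]))⟩
  | succ n ih_n =>
    induction d using Nat.strong_induction_on generalizing τ with | _ d ih_d =>
    have hR (I) : Interpolates (point q τ) (indexSetR (n + 1) d I)
        (exponentSet I (d - (n + 1 : ℕ) + I.card)) := by
      rcases lt_or_ge d (n + 1) with hd | hd
      · rw [indexSetR_eq_empty hd]
        exact .empty
      obtain ⟨d, rfl⟩ := Nat.exists_eq_add_of_le' hd
      rw [Nat.cast_add, add_sub_cancel_right]
      refine hτ.interpolates_indexSetR_succ (d := d + n) (fun J => ?_) ?_ I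
      · simpa using (ih_n hτ.comp_castSucc (d + n)).1 J
      · have := (ih_d d (by omega) hτ.smul).2 Finset.univ
        rw [indexSetT_univ, Finset.compl_univ] at this
        exact interpolates_indexSetR_empty hτ.q_ne_zero this
    refine ⟨hR, hτ.interpolates_indexSetT_succ (ih_n hτ.comp_castSucc d).2 ?_⟩
    simpa [indexSetR_univ] using hR Finset.univ

theorem interpolates_indexSet (hτ : IsGeneric q τ) (d : ℕ) :
    Interpolates (point q τ) (indexSet n d) (indexSet n d) := by
  have := (hτ.interpolates_indexSetR_and_indexSetT d).2 Finset.univ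
  rwa [indexSetT_univ, Finset.compl_univ, exponentSet_empty] at this

theorem eq_of_forall_eval_eq (hτ : IsGeneric q τ) {d : ℕ} {f g : LaurentPoly n}
    (hf : degree f ≤ (d : ℤ)) (hg : degree g ≤ (d : ℤ))
    (hfg : ∀ α ∈ indexSet n d, eval (point q τ α) f = eval (point q τ α) g) : f = g :=
  (hτ.interpolates_indexSet d).eq_of_eval_eq (finite_setOf_weight_le d) (finite_setOf_weight_le d)
    rfl (degree_le_iff.1 hf) (degree_le_iff.1 hg) hfg

theorem existsUnique_eval_eq (hτ : IsGeneric q τ) {d : ℕ} (v : indexSet n d → ℂ) :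
    ∃! f : LaurentPoly n, degree f ≤ ((d : ℤ) : WithBot ℤ) ∧
      ∀ α : indexSet n d, eval (point q τ α) f = v α := by
  obtain ⟨f, hf, hv⟩ := (hτ.interpolates_indexSet d).exists_eval_eq v
  exact ⟨f, ⟨degree_le_iff.2 hf, hv⟩, fun g ⟨hg, hgv⟩ =>
    hτ.eq_of_forall_eval_eq hg (degree_le_iff.2 hf) fun α hα =>
      (hgv ⟨α, hα⟩).trans (hv ⟨α, hα⟩).symm⟩

theorem existsUnique_isNonsymmetricInterp (hτ : IsGeneric q τ) (α : Fin n → ℤ) :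
    ∃! f : LaurentPoly n, IsNonsymmetricInterp q τ α f := by
  classical
  obtain ⟨d, hd⟩ := Int.eq_ofNat_of_zero_le (weight_nonneg α)
  have isNonsymmetricInterp_iff (f : LaurentPoly n) : IsNonsymmetricInterp q τ α f ↔
      degree f ≤ ((d : ℤ) : WithBot ℤ) ∧ ∀ β : indexSet n d,
        eval (point q τ β) f = if (β : Fin n → ℤ) = α then 1 else 0 := by
    rw [IsNonsymmetricInterp, hd]
    refine and_congr_right fun _ => ⟨fun ⟨h_one, h_zero⟩ β => ?_, fun h => ⟨?_, fun β hβ hne => ?_⟩⟩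
    · split_ifs with hβα
      · rw [hβα, h_one]
      · exact h_zero β β.2 hβα
    · exact (h ⟨α, hd.le⟩).trans (if_pos rfl)
    · exact (h ⟨β, hβ⟩).trans (if_neg hne)
  simpa only [isNonsymmetricInterp_iff] using hτ.existsUnique_eval_eq _

end IsGeneric

end LaurentInterp

theorem mainTheorem1_general (n : ℕ) (q : ℂ) (τ : Fin n → ℂ) (hτ : LaurentInterp.IsGeneric q τ)
    (d : ℕ) :
    (∀ (I : Finset (Fin n)) (fbar : LaurentInterp.indexSetR n d I → ℂ),
      ∃ f : LaurentInterp.LaurentPoly n,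
        (∀ α : LaurentInterp.indexSetR n d I,
          LaurentInterp.eval (LaurentInterp.point q τ α) f = fbar α) ∧
        ∀ J : Finset (Fin n), J ⊆ I →
          LaurentInterp.degree (LaurentInterp.xProd J * f) ≤
            (((d : ℤ) - (n : ℤ) + (I.card : ℤ) : ℤ) : WithBot ℤ)) ∧
    (∀ (I : Finset (Fin n)) (fbar : LaurentInterp.indexSetT n d I → ℂ),
      ∃ f : LaurentInterp.LaurentPoly n,
        (∀ α : LaurentInterp.indexSetT n d I,
          LaurentInterp.eval (LaurentInterp.point q τ α) f = fbar α) ∧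
        ∀ J : Finset (Fin n), J ⊆ Iᶜ →
          LaurentInterp.degree (LaurentInterp.xProd J * f) ≤ ((d : ℤ) : WithBot ℤ)) ∧
    (∀ fbar : LaurentInterp.indexSet n d → ℂ,
      ∃! f : LaurentInterp.LaurentPoly n,
        LaurentInterp.degree f ≤ ((d : ℤ) : WithBot ℤ) ∧
        ∀ α : LaurentInterp.indexSet n d,
          LaurentInterp.eval (LaurentInterp.point q τ α) f = fbar α) ∧
    (∀ α : Fin n → ℤ,
      ∃! f : LaurentInterp.LaurentPoly n, LaurentInterp.IsNonsymmetricInterp q τ α f) := by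
  obtain ⟨hR, hT⟩ := hτ.interpolates_indexSetR_and_indexSetT d
  refine ⟨fun I v => ?_, fun I v => ?_, fun v => hτ.existsUnique_eval_eq v,
    hτ.existsUnique_isNonsymmetricInterp⟩
  · obtain ⟨f, hf, hv⟩ := (hR I).exists_eval_eq v
    exact ⟨f, hv, fun J hJ => LaurentInterp.degree_xProd_mul_le hJ hf⟩
  · obtain ⟨f, hf, hv⟩ := (hT I).exists_eval_eq v
    exact ⟨f, hv, fun J hJ => LaurentInterp.degree_xProd_mul_le hJ hf⟩

theorem mainTheorem1 (n : ℕ) (hn : 0 < n) (q : ℂ) (hq0 : 0 < ‖q‖) (hq1 : ‖q‖ < 1)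
    (τ : Fin n → ℂ) (hτ : τ ∈ LaurentInterp.paramSet n) (d : ℕ) :
    (∀ (I : Finset (Fin n)) (fbar : LaurentInterp.indexSetR n d I → ℂ),
      ∃ f : LaurentInterp.LaurentPoly n,
        (∀ α : LaurentInterp.indexSetR n d I,
          LaurentInterp.eval (LaurentInterp.point q τ α) f = fbar α) ∧
        ∀ J : Finset (Fin n), J ⊆ I →
          LaurentInterp.degree (LaurentInterp.xProd J * f) ≤
            (((d : ℤ) - (n : ℤ) + (I.card : ℤ) : ℤ) : WithBot ℤ)) ∧
    (∀ (I : Finset (Fin n)) (fbar : LaurentInterp.indexSetT n d I → ℂ),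
      ∃ f : LaurentInterp.LaurentPoly n,
        (∀ α : LaurentInterp.indexSetT n d I,
          LaurentInterp.eval (LaurentInterp.point q τ α) f = fbar α) ∧
        ∀ J : Finset (Fin n), J ⊆ Iᶜ →
          LaurentInterp.degree (LaurentInterp.xProd J * f) ≤ ((d : ℤ) : WithBot ℤ)) ∧
    (∀ fbar : LaurentInterp.indexSet n d → ℂ,
      ∃! f : LaurentInterp.LaurentPoly n,
        LaurentInterp.degree f ≤ ((d : ℤ) : WithBot ℤ) ∧
        ∀ α : LaurentInterp.indexSet n d,
          LaurentInterp.eval (LaurentInterp.point q τ α) f = fbar α) ∧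
    (∀ α : Fin n → ℤ,
      ∃! f : LaurentInterp.LaurentPoly n, LaurentInterp.IsNonsymmetricInterp q τ α f) :=
  mainTheorem1_general n q τ (LaurentInterp.isGeneric_of_mem_paramSet hq0 hq1 hτ) d
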